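/- Let $k<n$ and let $\mathcal A^0=(H_1^0,\dots,H_n^0)$ be a central generic arrangement of hyperplanes in $\mathbb C^k$: $H_i^0=\ker\alpha_i$ with $\alpha_i$ a nonzero linear form, and any $m\le k$ of the $H_i^0$ meet in codimension $m$. For $t\in\mathbb C^n$ let $\mathcal A^t$ be the translated arrangement with hyperplanes $H_i^{t_i}=\{x:\alpha_i(x)=t_i\}$. For $L\subseteq[n]=\{1,\dots,n\}$ put $D_L=\{t\in\mathbb C^n:\bigcap_{p\in L}H_p^{t_p}\neq\emptyset\}$. The discriminantal arrangement $\mathcal B(n,k,\mathcal A^0)$ consists of the $D_L$ with $|L|=k+1$, and its intersection lattice is the set of all intersections of families of these $D_L$ (including the empty intersection $\mathbb C^n$). Call $\mathcal A^0$ very generic if the cardinality of this intersection lattice is the largest among all central generic arrangements of $n$ hyperplanes in $\mathbb C^k$, and non-very generic otherwise. An $r$-set is a set $\mathbb T=\{L_1,\dots,L_r\}$ of $r$ distinct subsets of $[n]$ of cardinality $k+1$ such that any $r-1$ of them have the same union as all $r$, and $L_i\cap L_j\ne\emptyset$ for $i<j$. A translate $\mathcal A^t$ is $K_{\mathbb T}$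 if for every $L\in\mathbb T$ one has $\bigcap_{p\in L}H_p^{t_p}\ne\emptyset$ and $\bigcap_{p\in L\cup\{i\}}H_p^{t_p}=\emptyset$ for all $i\notin L$. Given $l\in\bigcup_i L_i\setminus\bigcap_i L_i$ and $S_l\subseteq\{L\in\mathbb T: l\in L\}$, the translate $\mathcal A^t$ is almost $K_{\mathbb T}$ (with respect to $l,S_l$) if it is $K_{\mathbb T}$ but for $H_l$ and $S_l$, that is: for every $L\in\mathbb T\setminus S_l$, $\bigcap_{p\in L}H_p^{t_p}\neq\emptyset$ and $\bigcap_{p\in L\cup\{i\}}H_p^{t_p}=\emptyset$ for all $i\notin L$; and for every $L\in S_l$, $\bigcap_{p\in L}H_p^{t_p}=\emptyset$ and $\bigcap_{p\in (L\setminus\{l\})\cup\{i\}}H_p^{t_p}=\emptyset$ for all $i\notin L$. The arrangement $\mathcal A^0$ is $(r,s)$-dependent if there are an $r$-set $\mathbb T$, an index $l\in\bigcup_i L_i\setminus\bigcap_i L_i$ and a set $S_l\subseteq\{L\in\mathbb T:l\in L\}$ with $|S_l|=s$ such that at least one almost $K_{\mathbb T}$-translate (with respect to $l,S_l$) exists,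 and every such almost $K_{\mathbb T}$-translate becomes a $K_{\mathbb T}$-translate after a suitable translation of the single hyperplane $H_l$. Theorem. If $\mathcal A^0$ is $(r,s)$-dependent for some $r$ and some $s>1$, then $\mathcal A^0$ is non-very generic. -/

import Mathlib

namespace DiscArr

/-- A central arrangement of `n` (labelled) hyperplanes `H_i^0 = ker (α i)` in `ℂ^k`, each given by
a linear form. It is *generic* if the `α i` are nonzero (so that the kernels are hyperplanes) and
any `m ≤ k` of the hyperplanes meet in codimension `m`. -/
def CentralGeneric {n k : ℕ} (α : Fin n → Module.Dual ℂ (Fin k → ℂ)) : Prop :=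
  (∀ i, α i ≠ 0) ∧
  ∀ I : Finset (Fin n), I.card ≤ k →
    Module.finrank ℂ (⨅ i ∈ I, LinearMap.ker (α i) : Submodule ℂ (Fin k → ℂ)) + I.card = k

/-- The translate `H_i^c = {x | α_i x = c}` of `H_i^0`. The space of parallel translates of the
arrangement is thus identified with `ℂ^n`, the origin being the central arrangement itself. -/
def translate {n k : ℕ} (α : Fin n → Module.Dual ℂ (Fin k → ℂ)) (i : Fin n) (c : ℂ) :
    Set (Fin k → ℂ) :=
  {x | α i x = c}

/-- `⋂_{p ∈ L} H_p` for the translated arrangement `(H_1^{t_1}, …, H_n^{t_n})`. -/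
def inter {n k : ℕ} (α : Fin n → Module.Dual ℂ (Fin k → ℂ)) (t : Fin n → ℂ)
    (L : Finset (Fin n)) : Set (Fin k → ℂ) :=
  ⋂ p ∈ L, translate α p (t p)

/-- `D_L`: the translated arrangements in which the hyperplanes indexed by `L` have a common
point. For `|L| = k + 1` these are the hyperplanes of the discriminantal arrangement. -/
def D {n k : ℕ} (α : Fin n → Module.Dual ℂ (Fin k → ℂ)) (L : Finset (Fin n)) :
    Set (Fin n → ℂ) :=
  {t | (inter α t L).Nonempty}

/-- The intersection lattice of the discriminantal arrangement `B(n, k, α)`: all intersections of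
families of hyperplanes `D_L`, `|L| = k + 1` (the empty family gives the whole space). -/
def intersectionLattice {n k : ℕ} (α : Fin n → Module.Dual ℂ (Fin k → ℂ)) :
    Set (Set (Fin n → ℂ)) :=
  {X | ∃ F : Finset (Finset (Fin n)), (∀ L ∈ F, L.card = k + 1) ∧ X = ⋂ L ∈ F, D α L}

theorem intersectionLattice_finite {n k : ℕ} (α : Fin n → Module.Dual ℂ (Fin k → ℂ)) :
    (intersectionLattice α).Finite := by
  refine (Set.finite_range
    (fun F : Finset (Finset (Fin n)) => ⋂ L ∈ F, D α L)).subset ?_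
  rintro X ⟨F, -, rfl⟩
  exact ⟨F, rfl⟩

/-- A central generic arrangement is *very generic* if the intersection lattice of its
discriminantal arrangement has the largest cardinality possible among all central generic
arrangements of `n` hyperplanes in `ℂ^k`. -/
def VeryGeneric {n k : ℕ} (α : Fin n → Module.Dual ℂ (Fin k → ℂ)) : Prop :=
  CentralGeneric α ∧
  ∀ β : Fin n → Module.Dual ℂ (Fin k → ℂ), CentralGeneric β →
    (intersectionLattice β).ncard ≤ (intersectionLattice α).ncard

/-- `T = {L_1, …, L_r}` is an *`r`-set*: `r` distinct subsets of `[n]` of cardinality `k + 1` such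
that any `r - 1` of them have the same union as all of them and any two of them intersect. -/
def IsRSet {n : ℕ} (k r : ℕ) (T : Finset (Finset (Fin n))) : Prop :=
  T.card = r ∧
  (∀ L ∈ T, L.card = k + 1) ∧
  (∀ I : Finset (Finset (Fin n)), I ⊆ T → I.card + 1 = r → I.biUnion id = T.biUnion id) ∧
  (∀ L ∈ T, ∀ M ∈ T, L ≠ M → (L ∩ M).Nonempty)

/-- The translated arrangement `t` is `K_T`: for each `L ∈ T` the hyperplanes indexed by `L` have a
common point (the vertex `P_L`), and no further hyperplane goes through it. -/
def IsKT {n k : ℕ} (α : Fin n → Module.Dual ℂ (Fin k → ℂ)) (T : Finset (Finset (Fin n)))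
    (t : Fin n → ℂ) : Prop :=
  ∀ L ∈ T, (inter α t L).Nonempty ∧ ∀ i, i ∉ L → inter α t (insert i L) = ∅

/-- The translated arrangement `t` is almost `K_T` with respect to the index `l` and the set
`S ⊆ {L ∈ T | l ∈ L}`, that is, `K_T` but for the hyperplane `H_l` and the members of `S`.
For `L ∈ T \ S` the `K_T` conditions hold. For `L ∈ S` the hyperplanes indexed by `L` have
no common point, and the vertex `P_L` is the common point of those indexed by `L \ {l}`; as in the
`K_T` condition, no hyperplane with index outside `L` goes through it. -/
def IsAlmostKT {n k : ℕ} (α : Fin n → Module.Dual ℂ (Fin k → ℂ)) (T : Finset (Finset (Fin n)))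
    (l : Fin n) (S : Finset (Finset (Fin n))) (t : Fin n → ℂ) : Prop :=
  (∀ L ∈ T, L ∉ S →
    (inter α t L).Nonempty ∧ ∀ i, i ∉ L → inter α t (insert i L) = ∅) ∧
  (∀ L ∈ S,
    inter α t L = ∅ ∧ ∀ i, i ∉ L → inter α t (insert i (L.erase l)) = ∅)

/-- `(r, s)`-dependency: for some `r`-set `T`, some index `l` in the union but not in the
intersection of the members of `T`, and some `s`-element `S ⊆ {L ∈ T | l ∈ L}`, almost
`K_T`-translates exist and each of them becomes `K_T` after a suitable translation of the single
hyperplane `H_l`. -/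
def IsDependent {n k : ℕ} (α : Fin n → Module.Dual ℂ (Fin k → ℂ)) (r s : ℕ) : Prop :=
  ∃ (T : Finset (Finset (Fin n))) (l : Fin n) (S : Finset (Finset (Fin n))),
    IsRSet k r T ∧
    (∃ L ∈ T, l ∈ L) ∧ (∃ L ∈ T, l ∉ L) ∧
    (∀ L ∈ S, L ∈ T ∧ l ∈ L) ∧ S.card = s ∧
    (∃ t : Fin n → ℂ, IsAlmostKT α T l S t) ∧
    ∀ t : Fin n → ℂ, IsAlmostKT α T l S t → ∃ c : ℂ, IsKT α T (Function.update t l c)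

end DiscArr

/-! Each `D α L` with `|L| = k + 1` is the kernel of one functional `circuit α L`, so the
intersection lattice is the lattice of flats of a linear matroid. Let `L₁`, `L₂` be two members of
`S`. If the circuits of `T` were independent, an almost `K_T`-translate could be moved so that only
the value of the circuit of `L₁` changes; the shift of `H_l` repairing `L₂` stays the same, so it
cannot repair `L₁` both before and after (`not_linearIndepOn_of_almostKT`). Hence `T` contains a
minimal dependent family `J`, and the repaired translate is `K_J`.

A dimension count at that translate shows that every nonempty `I ⊆ J` covers at least `k + |I|`
indices (`hall_of_isKT`). By Hall's theorem, a matrix with generic entries and these row supports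
yields forms `γ`, possibly not generic, for which `J` carries no dependency
(`exists_relationMap_injective`). All but finitely many points of the line through `α` and `γ` are
generic, keep the independent families of `α` and make `J` independent (`exists_perturbation`). For
such a `β` the flats map onto those of `α`, with two of them identified, so the lattice of `β` is
strictly larger (`ncard_flatLattice_lt`). -/

namespace DiscArr

/-! ### Counting flats under a weak map of matroids -/

section FlatLattice

variable {K E V : Type*} [Field K] [AddCommGroup V] [Module K V]

/-- The lattice of all intersections of the hyperplanes `ker (f e)`, `e ∈ U`. -/
def flatLattice (f : E → Module.Dual K V) (U : Finset E) : Set (Set V) :=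
  {X | ∃ F ⊆ U, X = ⋂ e ∈ F, {t | f e t = 0}}

theorem flatLattice_finite (f : E → Module.Dual K V) (U : Finset E) :
    (flatLattice f U).Finite := by
  refine ((U.powerset : Finset (Finset E)).finite_toSet.image
    (fun F : Finset E => ⋂ e ∈ F, {t | f e t = 0})).subset ?_
  rintro X ⟨F, hF, rfl⟩
  exact ⟨F, by simpa using hF, rfl⟩

theorem mem_span_of_iInter_subset {f : E → Module.Dual K V} {B : Finset E} {g : Module.Dual K V}
    (h : ⋂ e ∈ B, {t | f e t = 0} ⊆ {t | g t = 0}) :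
    g ∈ Submodule.span K (f '' (B : Set E)) := by
  have key : g ∈ Submodule.span K (Set.range fun e : (B : Set E) => f e) := by
    refine mem_span_of_iInf_ker_le_ker fun t ht => ?_
    refine LinearMap.mem_ker.2 (h ?_)
    simp only [Submodule.mem_iInf, LinearMap.mem_ker, Subtype.forall] at ht
    simpa using ht
  rwa [Set.image_eq_range]

theorem eq_zero_of_mem_span {f : E → Module.Dual K V} {B : Set E} {g : Module.Dual K V}
    (hg : g ∈ Submodule.span K (f '' B)) {t : V} (ht : ∀ e ∈ B, f e t = 0) : g t = 0 := by
  induction hg using Submodule.span_induction with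
  | mem x hx => obtain ⟨e, he, rfl⟩ := hx; exact ht e he
  | zero => rfl
  | add x y _ _ hx hy => simp [hx, hy]
  | smul a x _ hx => simp [hx]

/-- The flat for `f` cut out by all hyperplanes whose `g`-counterparts contain `X`. -/
def flatTransfer (f g : E → Module.Dual K V) (U : Finset E) (X : Set V) : Set V :=
  ⋂ e ∈ {e | e ∈ U ∧ X ⊆ {t | g e t = 0}}, {t | f e t = 0}

/-- If `g e` lies in the `g`-span of `B` but `f e` not in its `f`-span, then `insert e B` is
`f`-independent and `g`-dependent, against `hfg`. -/
theorem flatTransfer_iInter [DecidableEq E] {f g : E → Module.Dual K V} {U B : Finset E}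
    (hfg : ∀ B ⊆ U, LinearIndepOn K f (B : Set E) → LinearIndepOn K g (B : Set E))
    (hBU : B ⊆ U) (hB : LinearIndepOn K f (B : Set E)) :
    flatTransfer f g U (⋂ e ∈ B, {t | g e t = 0}) = ⋂ e ∈ B, {t | f e t = 0} := by
  apply Set.Subset.antisymm
  · intro t ht
    simp only [flatTransfer, Set.mem_iInter] at ht
    simp only [Set.mem_iInter]
    exact fun e he => ht e ⟨hBU he, Set.biInter_subset_of_mem (s := (B : Set E)) he⟩
  · intro t ht
    simp only [Set.mem_iInter] at ht
    simp only [flatTransfer, Set.mem_iInter]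
    rintro e ⟨heU, he⟩
    by_cases heB : e ∈ B
    · exact ht e heB
    have heB' : e ∉ (B : Set E) := by simpa using heB
    have hspan : f e ∈ Submodule.span K (f '' (B : Set E)) := by
      by_contra hcon
      have h1 : LinearIndepOn K f ((insert e B : Finset E) : Set E) := by
        rw [Finset.coe_insert]
        exact (linearIndepOn_insert heB').2 ⟨hB, hcon⟩
      have h2 := hfg _ (Finset.insert_subset heU hBU) h1
      rw [Finset.coe_insert, linearIndepOn_insert heB'] at h2
      exact h2.2 (mem_span_of_iInter_subset he)
    exact eq_zero_of_mem_span hspan ht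

theorem exists_basis_iInter (f : E → Module.Dual K V) (F : Finset E) :
    ∃ B ⊆ F, LinearIndepOn K f (B : Set E) ∧
      ⋂ e ∈ F, {t | f e t = 0} = ⋂ e ∈ B, {t | f e t = 0} := by
  obtain ⟨b, hbF, -, hspan, hb⟩ :=
    exists_linearIndepOn_extension (linearIndepOn_empty K f) (Set.empty_subset (F : Set E))
  lift b to Finset E using F.finite_toSet.subset hbF
  refine ⟨b, by exact_mod_cast hbF, hb, Set.Subset.antisymm ?_ ?_⟩
  · exact Set.biInter_subset_biInter_left hbF
  · intro t ht
    simp only [Set.mem_iInter] at ht ⊢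
    exact fun e he => eq_zero_of_mem_span (hspan ⟨e, he, rfl⟩) ht

/-- If every `f`-independent family is `g`-independent and some circuit of `f` (not a loop) is
`g`-independent, then `g` has strictly more flats than `f`. -/
theorem ncard_flatLattice_lt [DecidableEq E] {f g : E → Module.Dual K V} {U C : Finset E}
    (hfg : ∀ B ⊆ U, LinearIndepOn K f (B : Set E) → LinearIndepOn K g (B : Set E))
    (hCU : C ⊆ U) (hCf : ¬ LinearIndepOn K f (C : Set E)) (hCg : LinearIndepOn K g (C : Set E))
    (hmin : ∀ e ∈ C, LinearIndepOn K f ((C.erase e : Finset E) : Set E))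
    (hC2 : 1 < C.card) :
    (flatLattice f U).ncard < (flatLattice g U).ncard := by
  have hspan : ∀ e ∈ C, f e ∈ Submodule.span K (f '' ((C.erase e : Finset E) : Set E)) := by
    intro e he
    by_contra hcon
    refine hCf ?_
    rw [← Finset.insert_erase he, Finset.coe_insert]
    exact (linearIndepOn_insert (by simp)).2 ⟨hmin e he, hcon⟩
  have herase : ∀ e ∈ C, flatTransfer f g U (⋂ c ∈ C.erase e, {t | g c t = 0}) =
      ⋂ c ∈ C, {t | f c t = 0} := by
    intro e he
    rw [flatTransfer_iInter hfg ((Finset.erase_subset _ _).trans hCU) (hmin e he)]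
    refine Set.Subset.antisymm (fun t ht => ?_)
      (Set.biInter_subset_biInter_left (by exact_mod_cast Finset.erase_subset e C))
    simp only [Set.mem_iInter] at ht ⊢
    intro c hc
    by_cases hce : c = e
    · subst hce
      exact eq_zero_of_mem_span (hspan c hc) ht
    · exact ht c (Finset.mem_erase.2 ⟨hce, hc⟩)
  obtain ⟨a, ha, b, hb, hab⟩ := Finset.one_lt_card.1 hC2
  set Xa : Set V := ⋂ c ∈ C.erase a, {t | g c t = 0} with hXa
  set Xb : Set V := ⋂ c ∈ C.erase b, {t | g c t = 0} with hXb
  -- Equality would make `g a` vanish on `Xa`, since `a ∈ C.erase b`, and so put `g a` in the span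
  -- of the rest of `C`.
  have hXab : Xb ≠ Xa := by
    intro h
    have hsub : ⋂ c ∈ C.erase a, {t | g c t = 0} ⊆ {t | g a t = 0} := by
      rw [← hXa, ← h]
      exact Set.biInter_subset_of_mem (s := ((C.erase b : Finset E) : Set E))
        (by simpa using ⟨ha, hab⟩)
    have := mem_span_of_iInter_subset hsub
    rw [← Finset.insert_erase ha, Finset.coe_insert, linearIndepOn_insert (by simp)] at hCg
    exact hCg.2 this
  have hmem : ∀ e, (⋂ c ∈ C.erase e, {t | g c t = 0}) ∈ flatLattice g U := fun e =>
    ⟨C.erase e, (Finset.erase_subset _ _).trans hCU, rfl⟩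
  have hfin := flatLattice_finite g U
  -- `Xa` can be omitted: `Xb` has the same transfer, because in the `f`-circuit `C` erasing any one
  -- element leaves the flat unchanged.
  have hsurj : flatLattice f U ⊆ flatTransfer f g U '' (flatLattice g U \ {Xa}) := by
    rintro Y ⟨F, hFU, rfl⟩
    obtain ⟨B, hBF, hB, hFB⟩ := exists_basis_iInter f F
    have hT := flatTransfer_iInter hfg (hBF.trans hFU) hB
    by_cases hX : (⋂ e ∈ B, {t | g e t = 0}) = Xa
    · refine ⟨Xb, ⟨hmem b, hXab⟩, ?_⟩
      rw [hFB, ← hT, hX, herase b hb, herase a ha]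
    · exact ⟨_, ⟨⟨B, hBF.trans hFU, rfl⟩, hX⟩, by rw [hFB, hT]⟩
  calc (flatLattice f U).ncard ≤ (flatTransfer f g U '' (flatLattice g U \ {Xa})).ncard :=
        Set.ncard_le_ncard hsurj ((hfin.subset Set.sdiff_subset).image _)
    _ ≤ (flatLattice g U \ {Xa}).ncard := Set.ncard_image_le (hfin.subset Set.sdiff_subset)
    _ < (flatLattice g U).ncard := Set.ncard_sdiff_singleton_lt_of_mem (hmem a) hfin

end FlatLattice

/-! ### Injectivity and surjectivity along a line of linear maps -/

section AffineFamily

variable {K V W : Type*} [Field K] [AddCommGroup V] [Module K V] [AddCommGroup W] [Module K W]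

theorem finite_not_injective_id_add_smul [FiniteDimensional K V] (N : Module.End K V) (z₀ : K) :
    {z | ¬ Function.Injective (LinearMap.id + (z - z₀) • N : V →ₗ[K] V)}.Finite := by
  have hfin := Module.End.finite_hasEigenvalue N
  -- A nonzero kernel vector is an eigenvector of `N` with eigenvalue `μ = -(z - z₀)⁻¹`, whence `z =
  -- z₀ - μ⁻¹`.
  refine (hfin.image fun μ => z₀ - μ⁻¹).subset fun z hz => ?_
  rw [Set.mem_ofPred_eq, ← LinearMap.ker_eq_bot, Submodule.eq_bot_iff] at hz
  push Not at hz
  obtain ⟨v, hv, hv0⟩ := hz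
  rw [LinearMap.mem_ker, LinearMap.add_apply, LinearMap.smul_apply, LinearMap.id_apply] at hv
  have hz0 : z - z₀ ≠ 0 := fun h => hv0 (by simpa [h] using hv)
  refine ⟨-(z - z₀)⁻¹, ?_, ?_⟩
  · refine Module.End.hasEigenvalue_of_hasEigenvector (x := v)
      (Module.End.hasEigenvector_iff.2 ⟨Module.End.mem_eigenspace_iff.2 ?_, hv0⟩)
    have h1 : (z - z₀) • N v = -v := (eq_neg_of_add_eq_zero_right hv)
    rw [neg_smul, ← smul_neg, ← h1, smul_smul, inv_mul_cancel₀ hz0, one_smul]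
  · simp [neg_inv]

/-- A left inverse `G` at `z₀` turns the family into `id + (z - z₀) • G ∘ B`, where only finitely
many eigenvalues matter. -/
theorem finite_not_injective_add_smul [FiniteDimensional K V] (A B : V →ₗ[K] W) (z₀ : K)
    (h : Function.Injective (A + z₀ • B)) :
    {z : K | ¬ Function.Injective (A + z • B)}.Finite := by
  obtain ⟨G, hG⟩ := LinearMap.exists_leftInverse_of_injective _ (LinearMap.ker_eq_bot.2 h)
  refine (finite_not_injective_id_add_smul (G ∘ₗ B) z₀).subset fun z hz hinj => hz ?_
  have : (LinearMap.id + (z - z₀) • G ∘ₗ B : V →ₗ[K] V) = G ∘ₗ (A + z • B) := by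
    rw [← hG, ← LinearMap.comp_smul, ← LinearMap.comp_add]
    congr 1
    rw [sub_smul]; abel
  rw [this, LinearMap.coe_comp] at hinj
  exact hinj.of_comp

theorem finite_not_surjective_add_smul [FiniteDimensional K W] (A B : V →ₗ[K] W) (z₀ : K)
    (h : Function.Surjective (A + z₀ • B)) :
    {z : K | ¬ Function.Surjective (A + z • B)}.Finite := by
  obtain ⟨G, hG⟩ := LinearMap.exists_rightInverse_of_surjective _ (LinearMap.range_eq_top.2 h)
  refine (finite_not_injective_id_add_smul (B ∘ₗ G) z₀).subset fun z hz hinj => hz ?_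
  have : (LinearMap.id + (z - z₀) • B ∘ₗ G : W →ₗ[K] W) = (A + z • B) ∘ₗ G := by
    rw [← hG, ← LinearMap.smul_comp, ← LinearMap.add_comp]
    congr 1
    rw [sub_smul]; abel
  rw [this] at hinj
  have := LinearMap.surjective_of_injective hinj
  rw [LinearMap.coe_comp] at this
  exact this.of_comp

end AffineFamily

/-! ### Relations among the forms and the functionals defining `D α L` -/

section Relations

variable {n k : ℕ}

theorem dual_apply_eq_sum (h : Module.Dual ℂ (Fin n → ℂ)) (t : Fin n → ℂ) :
    h t = ∑ i, t i * h (Pi.single i 1) := by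
  conv_lhs => rw [pi_eq_sum_univ' t]
  simp [map_sum]

/-- The linear relations among the forms `α i`, `i ∈ A`, as functionals on the space of translates. -/
def Rel (α : Fin n → Module.Dual ℂ (Fin k → ℂ)) (A : Finset (Fin n)) :
    Submodule ℂ (Module.Dual ℂ (Fin n → ℂ)) where
  carrier := {h | h ∘ₗ LinearMap.pi α = 0 ∧ ∀ i ∉ A, h (Pi.single i 1) = 0}
  add_mem' := by
    rintro a b ⟨ha, ha'⟩ ⟨hb, hb'⟩
    exact ⟨by rw [LinearMap.add_comp, ha, hb, add_zero], fun i hi => by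
      rw [LinearMap.add_apply, ha' i hi, hb' i hi, add_zero]⟩
  zero_mem' := by simp
  smul_mem' := by
    rintro c a ⟨ha, ha'⟩
    exact ⟨by rw [LinearMap.smul_comp, ha, smul_zero], fun i hi => by
      rw [LinearMap.smul_apply, ha' i hi, smul_zero]⟩

theorem Rel_mono (α : Fin n → Module.Dual ℂ (Fin k → ℂ)) {A B : Finset (Fin n)} (h : A ⊆ B) :
    Rel α A ≤ Rel α B :=
  fun _ hx => ⟨hx.1, fun i hi => hx.2 i fun hA => hi (h hA)⟩

theorem mem_D {α : Fin n → Module.Dual ℂ (Fin k → ℂ)} {A : Finset (Fin n)} {t : Fin n → ℂ} :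
    t ∈ D α A ↔ ∃ x, ∀ i ∈ A, α i x = t i := by
  simp [D, inter, translate, Set.Nonempty]

theorem inter_eq_empty_iff {α : Fin n → Module.Dual ℂ (Fin k → ℂ)} {A : Finset (Fin n)}
    {t : Fin n → ℂ} : inter α t A = ∅ ↔ t ∉ D α A :=
  Set.not_nonempty_iff_eq_empty.symm

theorem D_combo {α : Fin n → Module.Dual ℂ (Fin k → ℂ)} {A : Finset (Fin n)} {t u : Fin n → ℂ}
    (ht : t ∈ D α A) (hu : u ∈ D α A) (a b : ℂ) : a • t + b • u ∈ D α A := by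
  obtain ⟨x, hx⟩ := mem_D.1 ht
  obtain ⟨y, hy⟩ := mem_D.1 hu
  exact mem_D.2 ⟨a • x + b • y, fun i hi => by simp [hx i hi, hy i hi]⟩

theorem Rel_apply_eq_zero {α : Fin n → Module.Dual ℂ (Fin k → ℂ)} {A : Finset (Fin n)}
    {h : Module.Dual ℂ (Fin n → ℂ)} (hh : h ∈ Rel α A) {t : Fin n → ℂ} (ht : t ∈ D α A) :
    h t = 0 := by
  obtain ⟨x, hx⟩ := mem_D.1 ht
  have h1 : h (LinearMap.pi α x) = 0 := by
    rw [← LinearMap.comp_apply, hh.1, LinearMap.zero_apply]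
  rw [← h1, dual_apply_eq_sum h t, dual_apply_eq_sum h (LinearMap.pi α x)]
  refine Finset.sum_congr rfl fun i _ => ?_
  by_cases hi : i ∈ A
  · rw [LinearMap.pi_apply, hx i hi]
  · rw [hh.2 i hi, mul_zero, mul_zero]

/-- The values of the forms `α i`, `i ∈ A`. -/
def restrictEval (α : Fin n → Module.Dual ℂ (Fin k → ℂ)) (A : Finset (Fin n)) :
    (Fin k → ℂ) →ₗ[ℂ] (A → ℂ) :=
  LinearMap.pi fun i : A => α i

theorem ker_restrictEval (α : Fin n → Module.Dual ℂ (Fin k → ℂ)) (A : Finset (Fin n)) :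
    LinearMap.ker (restrictEval α A) = ⨅ i ∈ A, LinearMap.ker (α i) := by
  ext x
  simp [restrictEval, funext_iff]

theorem restrictEval_surjective_iff (α : Fin n → Module.Dual ℂ (Fin k → ℂ))
    (A : Finset (Fin n)) :
    Function.Surjective (restrictEval α A) ↔
      Module.finrank ℂ (⨅ i ∈ A, LinearMap.ker (α i) : Submodule ℂ (Fin k → ℂ)) + A.card = k := by
  have h := LinearMap.finrank_range_add_finrank_ker (restrictEval α A)
  rw [ker_restrictEval, Module.finrank_fin_fun] at h
  rw [← LinearMap.range_eq_top]
  constructor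
  · intro htop
    rw [htop, finrank_top, Module.finrank_fintype_fun_eq_card, Fintype.card_coe] at h
    omega
  · intro h'
    refine Submodule.eq_top_of_finrank_eq ?_
    rw [Module.finrank_fintype_fun_eq_card, Fintype.card_coe]
    omega

theorem centralGeneric_of_surjective {α : Fin n → Module.Dual ℂ (Fin k → ℂ)} (hk : 1 ≤ k)
    (h : ∀ A : Finset (Fin n), A.card ≤ k → Function.Surjective (restrictEval α A)) :
    CentralGeneric α := by
  refine ⟨fun i hi => ?_, fun I hI => (restrictEval_surjective_iff α I).1 (h I hI)⟩
  obtain ⟨x, hx⟩ := h {i} (by simpa using hk) 1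
  have := congrFun hx ⟨i, by simp⟩
  simp [restrictEval, hi] at this

theorem CentralGeneric.one_le {α : Fin n → Module.Dual ℂ (Fin k → ℂ)} (hα : CentralGeneric α)
    (hkn : k < n) : 1 ≤ k := by
  rcases Nat.eq_zero_or_pos k with rfl | hk
  · exact absurd (Subsingleton.elim _ _) (hα.1 ⟨0, hkn⟩)
  · exact hk

variable {α : Fin n → Module.Dual ℂ (Fin k → ℂ)}

theorem CentralGeneric.mem_D_of_card_le (hα : CentralGeneric α) {A : Finset (Fin n)} (hA : A.card ≤ k)
    (t : Fin n → ℂ) : t ∈ D α A := by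
  obtain ⟨x, hx⟩ := (restrictEval_surjective_iff α A).2 (hα.2 A hA) fun i => t i
  exact mem_D.2 ⟨x, fun i hi => congrFun hx ⟨i, hi⟩⟩

theorem CentralGeneric.Rel_eq_zero (hα : CentralGeneric α) {A : Finset (Fin n)} (hA : A.card ≤ k)
    {h : Module.Dual ℂ (Fin n → ℂ)} (hh : h ∈ Rel α A) : h = 0 :=
  LinearMap.ext fun t => Rel_apply_eq_zero hh (hα.mem_D_of_card_le hA t)

theorem CentralGeneric.point_unique (hα : CentralGeneric α) {A : Finset (Fin n)}
    (hA : A.card = k) {x y : Fin k → ℂ} (h : ∀ i ∈ A, α i x = α i y) : x = y := by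
  have h0 := hα.2 A hA.le
  have h1 : (⨅ i ∈ A, LinearMap.ker (α i) : Submodule ℂ (Fin k → ℂ)) = ⊥ := by
    rw [← Submodule.finrank_eq_zero (R := ℂ)]; omega
  rw [← ker_restrictEval, LinearMap.ker_eq_bot] at h1
  exact h1 (funext fun i => h i i.2)

/-- Evaluating `k + 1` forms on a `k`-dimensional space is not onto, so some functional kills the
range. A zero coefficient would leave a relation among `k` forms, excluded by genericity.
Conversely, `k` of the equations can be solved and the relation forces the last. -/
theorem CentralGeneric.exists_circuit (hα : CentralGeneric α) {L : Finset (Fin n)}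
    (hL : L.card = k + 1) :
    ∃ h ∈ Rel α L, (∀ i ∈ L, h (Pi.single i 1) ≠ 0) ∧ D α L = {t | h t = 0} := by
  have hlt : LinearMap.range (restrictEval α L) < ⊤ := by
    refine lt_top_iff_ne_top.2 fun htop => ?_
    have h1 := LinearMap.finrank_range_le (restrictEval α L)
    rw [htop, finrank_top, Module.finrank_fintype_fun_eq_card, Fintype.card_coe,
      Module.finrank_fin_fun] at h1
    omega
  obtain ⟨φ, hφ, hker⟩ := Submodule.exists_le_ker_of_lt_top _ hlt
  have hh : φ ∘ₗ LinearMap.funLeft ℂ ℂ (Subtype.val : L → Fin n) ∈ Rel α L := by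
    refine ⟨LinearMap.ext fun x => ?_, fun i hi => ?_⟩
    · exact LinearMap.mem_ker.1 (hker ⟨x, rfl⟩)
    · have : LinearMap.funLeft ℂ ℂ (Subtype.val : L → Fin n) (Pi.single i 1) = 0 := by
        ext j
        have : (j : Fin n) ≠ i := fun h => hi (h ▸ j.2)
        simp [LinearMap.funLeft_apply, this]
      rw [LinearMap.comp_apply, this, map_zero]
  have hne : φ ∘ₗ LinearMap.funLeft ℂ ℂ (Subtype.val : L → Fin n) ≠ 0 := by
    intro h0
    refine hφ (LinearMap.ext fun y => ?_)
    obtain ⟨t, rfl⟩ := LinearMap.funLeft_surjective_of_injective ℂ ℂ _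
      (Subtype.val_injective (p := (· ∈ L))) y
    exact LinearMap.congr_fun h0 t
  generalize φ ∘ₗ LinearMap.funLeft ℂ ℂ (Subtype.val : L → Fin n) = h at hh hne
  have hcoef : ∀ i ∈ L, h (Pi.single i 1) ≠ 0 := by
    intro i hi h0
    refine hne (hα.Rel_eq_zero (A := L.erase i) (by rw [Finset.card_erase_of_mem hi]; omega)
      ⟨hh.1, fun j hj => ?_⟩)
    by_cases hji : j = i
    · rwa [hji]
    · exact hh.2 j fun hjL => hj (Finset.mem_erase.2 ⟨hji, hjL⟩)
  refine ⟨h, hh, hcoef, Set.Subset.antisymm (fun t ht => Rel_apply_eq_zero hh ht) fun t ht => ?_⟩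
  obtain ⟨i, hi⟩ : L.Nonempty := Finset.card_pos.1 (by omega)
  obtain ⟨x, hx⟩ := mem_D.1
    (hα.mem_D_of_card_le (A := L.erase i) (by rw [Finset.card_erase_of_mem hi]; omega) t)
  refine mem_D.2 ⟨x, fun j hj => ?_⟩
  by_cases hji : j = i
  · subst hji
    have h1 : h (t - LinearMap.pi α x) = 0 := by
      rw [map_sub, ← LinearMap.comp_apply, hh.1, LinearMap.zero_apply, sub_zero]
      exact ht
    rw [dual_apply_eq_sum, Finset.sum_eq_single j] at h1
    · have h2 := (mul_eq_zero.1 h1).resolve_right (hcoef j hj)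
      exact (sub_eq_zero.1 h2).symm
    · intro b _ hbj
      by_cases hbL : b ∈ L
      · simp [hx b (Finset.mem_erase.2 ⟨hbj, hbL⟩)]
      · rw [hh.2 b hbL, mul_zero]
    · simp
  · exact hx j (Finset.mem_erase.2 ⟨hji, hj⟩)

/-- A relation is determined by its coefficients outside a `k`-subset `B`, since a relation
supported on `B` is zero. -/
theorem CentralGeneric.finrank_Rel_add_le (hα : CentralGeneric α) {A : Finset (Fin n)}
    (hA : k ≤ A.card) : Module.finrank ℂ (Rel α A) + k ≤ A.card := by
  obtain ⟨B, hBA, hB⟩ := Finset.exists_subset_card_eq hA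
  let ρ : Rel α A →ₗ[ℂ] ((A \ B : Finset (Fin n)) → ℂ) :=
    LinearMap.pi fun i => (LinearMap.applyₗ (Pi.single (i : Fin n) (1 : ℂ))) ∘ₗ (Rel α A).subtype
  have hρ : Function.Injective ρ := by
    rw [← LinearMap.ker_eq_bot, Submodule.eq_bot_iff]
    rintro ⟨h, hh⟩ h0
    have hB0 : h ∈ Rel α B := by
      refine ⟨hh.1, fun i hi => ?_⟩
      by_cases hiA : i ∈ A
      · exact congrFun (LinearMap.mem_ker.1 h0) ⟨i, Finset.mem_sdiff.2 ⟨hiA, hi⟩⟩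
      · exact hh.2 i hiA
    exact Subtype.ext (hα.Rel_eq_zero hB.le hB0)
  have h1 := LinearMap.finrank_le_finrank_of_injective hρ
  rw [Module.finrank_fintype_fun_eq_card, Fintype.card_coe, Finset.card_sdiff_of_subset hBA] at h1
  omega

open Classical in
/-- The defining functional of the hyperplane `D α L`. -/
noncomputable def circuit (α : Fin n → Module.Dual ℂ (Fin k → ℂ)) (L : Finset (Fin n)) :
    Module.Dual ℂ (Fin n → ℂ) :=
  if h : ∃ h ∈ Rel α L, (∀ i ∈ L, h (Pi.single i 1) ≠ 0) ∧ D α L = {t | h t = 0} then h.choose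
  else 0

theorem CentralGeneric.circuit_spec (hα : CentralGeneric α) {L : Finset (Fin n)}
    (hL : L.card = k + 1) :
    circuit α L ∈ Rel α L ∧ (∀ i ∈ L, circuit α L (Pi.single i 1) ≠ 0) ∧
      D α L = {t | circuit α L t = 0} := by
  have h := hα.exists_circuit hL
  rw [circuit, dif_pos h]
  exact h.choose_spec

theorem CentralGeneric.circuit_ne_zero (hα : CentralGeneric α) {L : Finset (Fin n)}
    (hL : L.card = k + 1) : circuit α L ≠ 0 := by
  obtain ⟨i, hi⟩ : L.Nonempty := Finset.card_pos.1 (by omega)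
  intro h
  exact (hα.circuit_spec hL).2.1 i hi (by rw [h]; rfl)

theorem CentralGeneric.eq_smul_circuit (hα : CentralGeneric α) {L : Finset (Fin n)}
    (hL : L.card = k + 1) {h : Module.Dual ℂ (Fin n → ℂ)} (hh : h ∈ Rel α L) :
    ∃ c : ℂ, h = c • circuit α L := by
  have hsub : ⋂ M ∈ ({L} : Finset (Finset (Fin n))), {t | circuit α M t = 0} ⊆ {t | h t = 0} := by
    intro t ht
    simp only [Finset.mem_singleton, Set.iInter_iInter_eq_left] at ht
    rw [← (hα.circuit_spec hL).2.2] at ht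
    exact Rel_apply_eq_zero hh ht
  have := mem_span_of_iInter_subset hsub
  rw [Finset.coe_singleton, Set.image_singleton, Submodule.mem_span_singleton] at this
  obtain ⟨c, hc⟩ := this
  exact ⟨c, hc.symm⟩

theorem CentralGeneric.intersectionLattice_eq (hα : CentralGeneric α) :
    intersectionLattice α =
      flatLattice (circuit α) (Finset.univ.filter fun L : Finset (Fin n) => L.card = k + 1) := by
  have key : ∀ F : Finset (Finset (Fin n)), (∀ L ∈ F, L.card = k + 1) →
      ⋂ L ∈ F, D α L = ⋂ L ∈ F, {t | circuit α L t = 0} := fun F hF =>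
    Set.iInter₂_congr fun L hL => (hα.circuit_spec (hF L hL)).2.2
  ext X
  constructor
  · rintro ⟨F, hF, rfl⟩
    exact ⟨F, fun L hL => by simpa using hF L hL, key F hF⟩
  · rintro ⟨F, hF, rfl⟩
    have hF' : ∀ L ∈ F, L.card = k + 1 := fun L hL => by simpa using hF hL
    exact ⟨F, hF', (key F hF').symm⟩

end Relations

/-! ### Generic matrices with prescribed row supports -/

section GenericMatrix

/-- A matrix with prescribed row supports such that, for each `i₀ ∈ P`, a combination of the rows
supported on the support of row `i₀` involves only row `i₀`, given matchings in the complement. -/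
theorem exists_matrix_of_matchings {ι σ : Type*} [Fintype ι] [DecidableEq ι] [DecidableEq σ]
    (supp : ι → Finset σ) (P : Finset ι)
    (hP : ∀ i₀ : P, ∃ f : {i // i ≠ (i₀ : ι)} → σ, Function.Injective f ∧
      ∀ i : {i // i ≠ (i₀ : ι)}, f i ∈ supp i \ supp i₀) :
    ∃ G : ι → σ → ℂ, (∀ i, ∀ j ∉ supp i, G i j = 0) ∧
      ∀ i₀ ∈ P, ∀ c : ι → ℂ, (∀ j ∉ supp i₀, ∑ i, c i * G i j = 0) → ∀ i ≠ i₀, c i = 0 := by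
  choose f hinj hf using hP
  let N (i₀ : P) : Matrix {i // i ≠ (i₀ : ι)} {i // i ≠ (i₀ : ι)} (MvPolynomial (ι × σ) ℂ) :=
    fun a b => if f i₀ b ∈ supp a then MvPolynomial.X ((a : ι), f i₀ b) else 0
  have hN : ∀ i₀ : P, (N i₀).det ≠ 0 := by
    intro i₀ h0
    -- The 0-1 point of the matching specialises `N i₀` to the identity.
    let x : ι × σ → ℂ := fun p => if ∃ h : p.1 ≠ (i₀ : ι), p.2 = f i₀ ⟨p.1, h⟩ then 1 else 0
    have h1 : (MvPolynomial.eval x) (N i₀).det = 1 := by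
      have hmap : (MvPolynomial.eval x).mapMatrix (N i₀) = 1 := by
        ext a b
        change MvPolynomial.eval x (if f i₀ b ∈ supp a then MvPolynomial.X ((a : ι), f i₀ b) else 0)
          = (1 : Matrix _ _ ℂ) a b
        by_cases hab : a = b
        · subst hab
          have h2 := (Finset.mem_sdiff.1 (hf i₀ a)).1
          rw [if_pos h2, MvPolynomial.eval_X, Matrix.one_apply_eq]
          exact if_pos ⟨a.2, rfl⟩
        · have h2 : f i₀ b ≠ f i₀ a := fun h => hab (hinj i₀ h).symm
          rw [Matrix.one_apply_ne hab]
          split_ifs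
          · rw [MvPolynomial.eval_X]
            exact if_neg fun h => h2 h.2
          · rw [map_zero]
      rw [RingHom.map_det, hmap, Matrix.det_one]
    rw [h0, map_zero] at h1
    exact zero_ne_one h1
  -- A product of nonzero polynomials is nonzero, so one point serves all `i₀ ∈ P` at once.
  obtain ⟨x, hx⟩ : ∃ x : ι × σ → ℂ, (MvPolynomial.eval x) (∏ i₀ : P, (N i₀).det) ≠ 0 := by
    by_contra! hcon
    exact Finset.prod_ne_zero_iff.2 (fun i₀ _ => hN i₀) (MvPolynomial.funext fun x => by rw [hcon x, map_zero])
  rw [map_prod, Finset.prod_ne_zero_iff] at hx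
  refine ⟨fun i j => if j ∈ supp i then x (i, j) else 0, fun i j hj => if_neg hj, ?_⟩
  intro i₀ hi₀ c hc i hi
  lift i₀ to P using hi₀
  have hdet := hx i₀ (Finset.mem_univ _)
  rw [RingHom.map_det] at hdet
  have hzero : Matrix.vecMul (fun a : {i // i ≠ (i₀ : ι)} => c a)
      ((MvPolynomial.eval x).mapMatrix (N i₀)) = 0 := by
    ext b
    obtain ⟨-, hb⟩ := Finset.mem_sdiff.1 (hf i₀ b)
    have h1 := hc _ hb
    beta_reduce at h1
    rw [← Finset.add_sum_erase _ _ (Finset.mem_univ (i₀ : ι)), if_neg hb, mul_zero, zero_add] at h1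
    rw [Pi.zero_apply, ← h1, Matrix.vecMul, dotProduct]
    symm
    rw [Finset.sum_subtype (p := fun i => i ≠ (i₀ : ι)) _ (by simp)]
    refine Finset.sum_congr rfl fun a _ => ?_
    change c a * (if f i₀ b ∈ supp a then x (a, f i₀ b) else 0) = c a *
      MvPolynomial.eval x (if f i₀ b ∈ supp a then MvPolynomial.X ((a : ι), f i₀ b) else 0)
    split_ifs <;> simp
  exact congrFun (Matrix.eq_zero_of_vecMul_eq_zero hdet hzero) ⟨i, hi⟩

/-- Applying `hall` to `s` together with `i₀` and removing the `k + 1` columns of `supp i₀` leaves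
at least `|s|` columns: Hall's condition off `supp i₀`. -/
theorem exists_matching_compl {ι σ : Type*} [DecidableEq ι] [DecidableEq σ] {k : ℕ}
    (supp : ι → Finset σ) (hall : ∀ I : Finset ι, I.Nonempty → k + I.card ≤ (I.biUnion supp).card)
    {i₀ : ι} (hi₀ : (supp i₀).card = k + 1) :
    ∃ f : {i // i ≠ i₀} → σ, Function.Injective f ∧ ∀ i : {i // i ≠ i₀}, f i ∈ supp i \ supp i₀ := by
  refine (Finset.all_card_le_biUnion_card_iff_exists_injective
    fun i : {i // i ≠ i₀} => supp i \ supp i₀).1 fun s => ?_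
  have h1 := hall (insert i₀ (s.map (Function.Embedding.subtype _))) (Finset.insert_nonempty _ _)
  rw [Finset.card_insert_of_notMem (by simp), Finset.card_map, Finset.biUnion_insert] at h1
  have h2 : supp i₀ ∪ (s.map (Function.Embedding.subtype _)).biUnion supp ⊆
      supp i₀ ∪ s.biUnion fun i => supp i \ supp i₀ := by
    intro j
    simp only [Finset.mem_union, Finset.mem_biUnion, Finset.mem_map, Finset.mem_sdiff]
    rintro (hj | ⟨_, ⟨a, ha, rfl⟩, hj⟩)
    · exact Or.inl hj
    · by_cases hj0 : j ∈ supp i₀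
      · exact Or.inl hj0
      · exact Or.inr ⟨a, ha, hj, hj0⟩
  have h3 := (Finset.card_le_card h2).trans (Finset.card_union_le _ _)
  omega

end GenericMatrix

/-! ### Independence as injectivity of a map depending affinely on the forms -/

section RelationMap

variable {n k : ℕ}

/-- The linear map whose kernel consists of the families of relations, one supported on each
`L ∈ F`, that sum to zero. -/
def relationMap (α : Fin n → Module.Dual ℂ (Fin k → ℂ)) (F : Finset (Finset (Fin n))) :
    (F → Module.Dual ℂ (Fin n → ℂ)) →ₗ[ℂ]
      Module.Dual ℂ (Fin n → ℂ) × (F → Module.Dual ℂ (Fin k → ℂ)) × (F → Fin n → ℂ) where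
  toFun w := (∑ L, w L, fun L => w L ∘ₗ LinearMap.pi α,
    fun L i => if i ∈ (L : Finset (Fin n)) then 0 else w L (Pi.single i 1))
  map_add' v w := by
    refine Prod.ext (by simp [Finset.sum_add_distrib]) (Prod.ext ?_ ?_)
    · funext L; simp [LinearMap.add_comp]
    · funext L i; by_cases h : i ∈ (L : Finset (Fin n)) <;> simp [h]
  map_smul' c w := by
    refine Prod.ext (by simp [Finset.smul_sum]) (Prod.ext ?_ ?_)
    · funext L; simp [LinearMap.smul_comp]
    · funext L i; by_cases h : i ∈ (L : Finset (Fin n)) <;> simp [h]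

theorem relationMap_eq_zero_iff {α : Fin n → Module.Dual ℂ (Fin k → ℂ)}
    {F : Finset (Finset (Fin n))} {w : F → Module.Dual ℂ (Fin n → ℂ)} :
    relationMap α F w = 0 ↔ ∑ L, w L = 0 ∧ ∀ L : F, w L ∈ Rel α L := by
  simp only [relationMap, LinearMap.coe_mk, AddHom.coe_mk, Prod.mk_eq_zero, funext_iff,
    Pi.zero_apply, ite_eq_left_iff]
  exact and_congr_right fun _ => ⟨fun h L => ⟨h.1 L, h.2 L⟩, fun h => ⟨fun L => (h L).1,
    fun L => (h L).2⟩⟩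

theorem relationMap_injective_iff {α : Fin n → Module.Dual ℂ (Fin k → ℂ)}
    {F : Finset (Finset (Fin n))} :
    Function.Injective (relationMap α F) ↔
      ∀ w : F → Module.Dual ℂ (Fin n → ℂ), ∑ L, w L = 0 → (∀ L : F, w L ∈ Rel α L) → w = 0 := by
  rw [injective_iff_map_eq_zero]
  exact forall_congr' fun w => by rw [relationMap_eq_zero_iff, and_imp]

/-- Relations supported on `L` are multiples of `circuit α L`. The right-hand side avoids the
arbitrary choice of circuits and can be deformed with `α`. -/
theorem CentralGeneric.linearIndepOn_circuit_iff {α : Fin n → Module.Dual ℂ (Fin k → ℂ)}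
    (hα : CentralGeneric α) {F : Finset (Finset (Fin n))} (hF : ∀ L ∈ F, L.card = k + 1) :
    LinearIndepOn ℂ (circuit α) (F : Set (Finset (Fin n))) ↔
      Function.Injective (relationMap α F) := by
  have key : LinearIndepOn ℂ (circuit α) (F : Set (Finset (Fin n))) ↔
      ∀ c : F → ℂ, ∑ L : F, c L • circuit α (L : Finset (Fin n)) = 0 → ∀ L, c L = 0 :=
    Fintype.linearIndependent_iff (v := fun L : F => circuit α (L : Finset (Fin n)))
  rw [relationMap_injective_iff, key]
  constructor
  · intro h w hw hR
    choose c hc using fun L : F => hα.eq_smul_circuit (hF L L.2) (hR L)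
    have h0 := h c (by rw [← hw]; exact Finset.sum_congr rfl fun L _ => (hc L).symm)
    funext L
    rw [hc L, h0 L, zero_smul, Pi.zero_apply]
  · intro h c hc L
    have h0 := congrFun (h (fun L : F => c L • circuit α (L : Finset (Fin n))) hc fun L =>
      (Rel α L).smul_mem _ (hα.circuit_spec (hF L L.2)).1) L
    exact (smul_eq_zero.1 h0).resolve_right (hα.circuit_ne_zero (hF L L.2))

/-- The common zeros of `R` form a copy of `ℂ^k` inside `ℂ^n`; the `γ i` are the coordinates
restricted to it. -/
theorem exists_forms_of_relations (R : Submodule ℂ (Module.Dual ℂ (Fin n → ℂ)))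
    (hR : Module.finrank ℂ R + k = n) :
    ∃ γ : Fin n → Module.Dual ℂ (Fin k → ℂ),
      ∀ h : Module.Dual ℂ (Fin n → ℂ), h ∘ₗ LinearMap.pi γ = 0 → h ∈ R := by
  have h1 := Subspace.finrank_add_finrank_dualCoannihilator_eq R
  rw [Module.finrank_fin_fun] at h1
  let e : (Fin k → ℂ) ≃ₗ[ℂ] R.dualCoannihilator :=
    LinearEquiv.ofFinrankEq _ _ (by rw [Module.finrank_fin_fun]; omega)
  refine ⟨fun i => LinearMap.proj i ∘ₗ R.dualCoannihilator.subtype ∘ₗ e.toLinearMap,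
    fun h hh => ?_⟩
  rw [← Subspace.dualCoannihilator_dualAnnihilator_eq (W := R), Submodule.mem_dualAnnihilator]
  intro t ht
  have h2 := LinearMap.congr_fun hh (e.symm ⟨t, ht⟩)
  rw [LinearMap.comp_apply, LinearMap.zero_apply] at h2
  convert h2
  ext i
  simp

/-- Under Hall's condition some arrangement makes the family of relations independent. -/
theorem exists_relationMap_injective {J : Finset (Finset (Fin n))}
    (hJ : ∀ L ∈ J, L.card = k + 1)
    (hall : ∀ I ⊆ J, I.Nonempty → k + I.card ≤ (I.biUnion id).card) (hJ2 : 1 < J.card) :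
    ∃ γ : Fin n → Module.Dual ℂ (Fin k → ℂ), Function.Injective (relationMap γ J) := by
  have hJn : k + J.card ≤ n :=
    (hall J subset_rfl (Finset.card_pos.1 (by omega))).trans
      ((Finset.card_le_univ _).trans (Fintype.card_fin n).le)
  -- Rows of full support pad the system to `n - k` rows, the dimension required of the relation
  -- space.
  let ι := J ⊕ Fin (n - k - J.card)
  have hι : Fintype.card ι + k = n := by
    simp only [ι, Fintype.card_sum, Fintype.card_coe, Fintype.card_fin]; omega
  let supp : ι → Finset (Fin n) := Sum.elim (fun L => L) fun _ => Finset.univ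
  have hall' : ∀ I : Finset ι, I.Nonempty → k + I.card ≤ (I.biUnion supp).card := by
    intro I hI
    by_cases hr : ∃ a, Sum.inr a ∈ I
    · obtain ⟨a, ha⟩ := hr
      have h1 : Finset.univ ⊆ I.biUnion supp := Finset.subset_biUnion_of_mem supp ha
      have h2 := Finset.card_le_card h1
      rw [Finset.card_univ, Fintype.card_fin] at h2
      have h3 := Finset.card_le_univ I
      omega
    · push Not at hr
      have hIJ : ∀ i ∈ I, ∃ L : J, i = Sum.inl L := by
        rintro (L | a) hi
        · exact ⟨L, rfl⟩
        · exact absurd hi (hr a)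
      have h1 := hall (I.image supp) (by
        intro L hL
        obtain ⟨i, hi, rfl⟩ := Finset.mem_image.1 hL
        obtain ⟨L, rfl⟩ := hIJ i hi
        exact L.2) (hI.image _)
      rw [Finset.image_biUnion, Finset.card_image_of_injOn] at h1
      · exact h1
      · intro i hi j hj hij
        obtain ⟨L, rfl⟩ := hIJ i hi
        obtain ⟨M, rfl⟩ := hIJ j hj
        exact congrArg Sum.inl (Subtype.ext hij)
  obtain ⟨G, hG0, hG⟩ := exists_matrix_of_matchings supp
    (Finset.univ.filter fun i => (supp i).card = k + 1) fun i₀ =>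
      exists_matching_compl supp hall' (Finset.mem_filter.1 i₀.2).2
  have hG' : ∀ L : J, ∀ c : ι → ℂ, (∀ j ∉ (L : Finset (Fin n)), ∑ i, c i * G i j = 0) →
      ∀ i ≠ Sum.inl L, c i = 0 := fun L =>
    hG (Sum.inl L) (Finset.mem_filter.2 ⟨Finset.mem_univ _, hJ L L.2⟩)
  let g : ι → Module.Dual ℂ (Fin n → ℂ) := fun i => Fintype.linearCombination ℂ (G i)
  have hg : ∀ (c : ι → ℂ) (j : Fin n), (∑ i, c i • g i) (Pi.single j 1) = ∑ i, c i * G i j := by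
    intro c j
    simp [g, LinearMap.sum_apply, Fintype.linearCombination_apply_single]
  have hli : ∀ c : ι → ℂ, ∑ i, c i • g i = 0 → ∀ i, c i = 0 := by
    intro c hc i
    -- The condition at `L` kills every coefficient except that of row `L`; the condition at a
    -- second member `M` kills that one.
    obtain ⟨L, hL, M, hM, hLM⟩ := Finset.one_lt_card.1 hJ2
    have hc' : ∀ j, ∑ i, c i * G i j = 0 := fun j => by rw [← hg, hc, LinearMap.zero_apply]
    by_cases hi : i = Sum.inl ⟨L, hL⟩
    · refine hG' ⟨M, hM⟩ c (fun j _ => hc' j) i fun h => hLM ?_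
      rw [hi] at h
      exact congrArg Subtype.val (Sum.inl_injective h)
    · exact hG' ⟨L, hL⟩ c (fun j _ => hc' j) i hi
  obtain ⟨γ, hγ⟩ := exists_forms_of_relations (k := k) (Submodule.span ℂ (Set.range g)) (by
    rw [finrank_span_eq_card (Fintype.linearIndependent_iff.2 hli)]; exact hι)
  refine ⟨γ, relationMap_injective_iff.2 fun w hw hR => ?_⟩
  have hwg : ∀ L : J, ∃ c : ℂ, w L = c • g (Sum.inl L) := by
    intro L
    obtain ⟨c, hc⟩ := (Submodule.mem_span_range_iff_exists_fun ℂ).1 (hγ _ (hR L).1)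
    have h0 := hG' L c fun j hj => by rw [← hg, hc]; exact (hR L).2 j hj
    refine ⟨c (Sum.inl L), ?_⟩
    rw [← hc]
    exact Finset.sum_eq_single _ (fun i _ hi => by rw [h0 i hi, zero_smul]) (by simp)
  choose c hc using hwg
  have h0 := hli (Sum.elim c 0) (by
    rw [Fintype.sum_sum_type]
    simp only [Sum.elim_inl, Sum.elim_inr, Pi.zero_apply, zero_smul, Finset.sum_const_zero,
      add_zero, ← hc, hw])
  funext L
  rw [hc L, show c L = 0 from h0 (Sum.inl L), zero_smul, Pi.zero_apply]

end RelationMap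

/-! ### Perturbing towards `γ` -/

section Perturbation

variable {n k : ℕ} {α : Fin n → Module.Dual ℂ (Fin k → ℂ)}

/-- The dependence of `relationMap` on a perturbation `δ` of the forms. -/
def relationMapDeriv (δ : Fin n → Module.Dual ℂ (Fin k → ℂ)) (F : Finset (Finset (Fin n))) :
    (F → Module.Dual ℂ (Fin n → ℂ)) →ₗ[ℂ]
      Module.Dual ℂ (Fin n → ℂ) × (F → Module.Dual ℂ (Fin k → ℂ)) × (F → Fin n → ℂ) where
  toFun w := (0, fun L => w L ∘ₗ LinearMap.pi δ, 0)
  map_add' v w := by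
    refine Prod.ext (by simp) (Prod.ext ?_ (by simp))
    funext L; simp [LinearMap.add_comp]
  map_smul' c w := by
    refine Prod.ext (by simp) (Prod.ext ?_ (by simp))
    funext L; simp [LinearMap.smul_comp]

theorem relationMap_add_smul (α δ : Fin n → Module.Dual ℂ (Fin k → ℂ))
    (F : Finset (Finset (Fin n))) (z : ℂ) :
    relationMap (α + z • δ) F = relationMap α F + z • relationMapDeriv δ F := by
  have hpi : LinearMap.pi (α + z • δ) = LinearMap.pi α + z • LinearMap.pi δ := rfl
  refine LinearMap.ext fun w => Prod.ext ?_ (Prod.ext ?_ ?_)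
  · simp [relationMap, relationMapDeriv]
  · funext L
    simp [relationMap, relationMapDeriv, hpi, LinearMap.comp_add, LinearMap.comp_smul]
  · simp [relationMap, relationMapDeriv]

theorem restrictEval_add_smul (α δ : Fin n → Module.Dual ℂ (Fin k → ℂ)) (A : Finset (Fin n))
    (z : ℂ) : restrictEval (α + z • δ) A = restrictEval α A + z • restrictEval δ A := rfl

/-- Moving a generic arrangement `α` towards `γ` yields a generic arrangement which keeps all the
independent families of `α` independent, and also a family that is independent for `γ`. -/
theorem CentralGeneric.exists_perturbation (hα : CentralGeneric α) (hk : 1 ≤ k)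
    {J : Finset (Finset (Fin n))} (hJ : ∀ L ∈ J, L.card = k + 1)
    {γ : Fin n → Module.Dual ℂ (Fin k → ℂ)} (hγ : Function.Injective (relationMap γ J)) :
    ∃ β : Fin n → Module.Dual ℂ (Fin k → ℂ), CentralGeneric β ∧
      (∀ B : Finset (Finset (Fin n)), (∀ L ∈ B, L.card = k + 1) →
        LinearIndepOn ℂ (circuit α) (B : Set (Finset (Fin n))) →
        LinearIndepOn ℂ (circuit β) (B : Set (Finset (Fin n)))) ∧
      LinearIndepOn ℂ (circuit β) (J : Set (Finset (Fin n))) := by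
  -- The line passes through `α` at `z = 0` and `γ` at `z = 1`; each required property holds at one
  -- of these points, hence off a finite set.
  set δ := γ - α with hδ
  have h1 : ∀ F ∈ {F : Finset (Finset (Fin n)) | Function.Injective (relationMap α F)},
      {z : ℂ | ¬ Function.Injective (relationMap (α + z • δ) F)}.Finite := by
    intro F hF
    simp only [relationMap_add_smul]
    exact finite_not_injective_add_smul _ _ 0 (by simpa using hF)
  have h2 : ∀ A ∈ {A : Finset (Fin n) | A.card ≤ k},
      {z : ℂ | ¬ Function.Surjective (restrictEval (α + z • δ) A)}.Finite := by
    intro A hA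
    simp only [restrictEval_add_smul]
    exact finite_not_surjective_add_smul _ _ 0
      (by simpa using (restrictEval_surjective_iff α A).2 (hα.2 A hA))
  have h3 : {z : ℂ | ¬ Function.Injective (relationMap (α + z • δ) J)}.Finite := by
    simp only [relationMap_add_smul]
    refine finite_not_injective_add_smul _ _ 1 ?_
    rw [← relationMap_add_smul, one_smul, hδ, add_sub_cancel]
    exact hγ
  obtain ⟨z, hz⟩ := (((Set.toFinite _).biUnion h1).union
    (((Set.toFinite _).biUnion h2).union h3)).exists_notMem
  simp only [Set.mem_union, Set.mem_iUnion, Set.mem_ofPred_eq, not_or, not_exists,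
    not_not] at hz
  obtain ⟨hz1, hz2, hz3⟩ := hz
  have hβ : CentralGeneric (α + z • δ) := centralGeneric_of_surjective hk hz2
  exact ⟨α + z • δ, hβ, fun B hB hBα => (hβ.linearIndepOn_circuit_iff hB).2
    (hz1 B ((hα.linearIndepOn_circuit_iff hB).1 hBα)), (hβ.linearIndepOn_circuit_iff hJ).2 hz3⟩

end Perturbation

/-! ### What translates say about dependency -/

section Translates

variable {n k : ℕ} {α : Fin n → Module.Dual ℂ (Fin k → ℂ)}

theorem CentralGeneric.one_lt_card_of_dependent (hα : CentralGeneric α)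
    {J : Finset (Finset (Fin n))} (hJ : ∀ L ∈ J, L.card = k + 1)
    (hdep : ¬ LinearIndepOn ℂ (circuit α) (J : Set (Finset (Fin n)))) : 1 < J.card := by
  by_contra! hcard
  rcases Nat.le_one_iff_eq_zero_or_eq_one.1 hcard with h | h
  · rw [Finset.card_eq_zero.1 h] at hdep
    exact hdep (by simp)
  · obtain ⟨L, rfl⟩ := Finset.card_eq_one.1 h
    refine hdep ?_
    rw [Finset.coe_singleton, linearIndepOn_singleton_iff]
    exact hα.circuit_ne_zero (hJ L (Finset.mem_singleton_self L))

theorem span_circuit_le_Rel (hα : CentralGeneric α) {I : Finset (Finset (Fin n))}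
    {A : Finset (Fin n)} (hI : ∀ L ∈ I, L.card = k + 1) (hIA : ∀ L ∈ I, L ⊆ A) :
    Submodule.span ℂ (circuit α '' (I : Set (Finset (Fin n)))) ≤ Rel α A := by
  rw [Submodule.span_le]
  rintro _ ⟨L, hL, rfl⟩
  exact Rel_mono α (hIA L hL) (hα.circuit_spec (hI L hL)).1

theorem finrank_span_circuit {I : Finset (Finset (Fin n))}
    (hI : LinearIndepOn ℂ (circuit α) (I : Set (Finset (Fin n)))) :
    Module.finrank ℂ (Submodule.span ℂ (circuit α '' (I : Set (Finset (Fin n))))) = I.card := by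
  have h := finrank_span_eq_card (b := fun L : I => circuit α (L : Finset (Fin n))) hI
  rw [Fintype.card_coe] at h
  rw [← h, Set.image_eq_range]
  rfl

/-- A circuit among the hyperplanes `D α L` with a translate having no further incidences satisfies
Hall's condition. -/
theorem CentralGeneric.hall_of_isKT (hα : CentralGeneric α)
    {J : Finset (Finset (Fin n))} (hJ : ∀ L ∈ J, L.card = k + 1) (hJ2 : 1 < J.card)
    (hmin : ∀ L ∈ J, LinearIndepOn ℂ (circuit α) ((J.erase L : Finset _) : Set (Finset (Fin n))))
    {t : Fin n → ℂ} (ht : IsKT α J t) {I : Finset (Finset (Fin n))} (hIJ : I ⊆ J)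
    (hI : I.Nonempty) : k + I.card ≤ (I.biUnion id).card := by
  obtain ⟨L, hL⟩ := hI
  have hsub : ∀ M ∈ I, M ⊆ I.biUnion id := fun M hM => Finset.subset_biUnion_of_mem id hM
  have hkA : k ≤ (I.biUnion id).card := by
    have := Finset.card_le_card (hsub L hL)
    have := hJ L (hIJ hL)
    omega
  have hrank := hα.finrank_Rel_add_le hkA
  by_cases hIJ' : J ⊆ I
  · obtain rfl := Finset.Subset.antisymm hIJ hIJ'
    -- If Hall fails for `J` itself, the circuits of `I.erase L` already span all relations on the
    -- union, so every such relation vanishes at `t`.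
    by_contra! hlt
    have hle : Submodule.span ℂ (circuit α '' ((I.erase L : Finset _) : Set (Finset (Fin n)))) ≤
        Rel α (I.biUnion id) :=
      span_circuit_le_Rel hα (fun M hM => hJ M (Finset.mem_of_mem_erase hM))
        fun M hM => hsub M (Finset.mem_of_mem_erase hM)
    have heq := Submodule.eq_of_le_of_finrank_le hle (by
      rw [finrank_span_circuit (hmin L hL), Finset.card_erase_of_mem hL]; omega)
    have hvanish : ∀ h ∈ Rel α (I.biUnion id), h t = 0 := by
      intro h hh
      rw [← heq] at hh
      refine eq_zero_of_mem_span hh fun M hM => ?_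
      have hM' : M ∈ I := Finset.mem_of_mem_erase hM
      exact Rel_apply_eq_zero (hα.circuit_spec (hJ M hM')).1 (ht M hM').1
    -- Exchanging some `j ∈ L` for `i ∈ M \ L` gives hyperplanes with a common point; the `k`
    -- retained ones determine it as the vertex of `L`, so `H_i` passes through that vertex, against
    -- `K_J`.
    obtain ⟨M, hM, hML⟩ := Finset.exists_mem_ne hJ2 L
    obtain ⟨i, hiM, hiL⟩ : ∃ i ∈ M, i ∉ L := by
      by_contra! hcon
      exact hML (Finset.eq_of_subset_of_card_le hcon (by rw [hJ L hL, hJ M hM]))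
    obtain ⟨j, hj⟩ : L.Nonempty := Finset.card_pos.1 (by rw [hJ L hL]; omega)
    have hjcard : (L.erase j).card = k := by rw [Finset.card_erase_of_mem hj, hJ L hL]; omega
    have hcard : (insert i (L.erase j)).card = k + 1 := by
      rw [Finset.card_insert_of_notMem fun h => hiL (Finset.mem_of_mem_erase h), hjcard]
    have hL' : insert i (L.erase j) ⊆ I.biUnion id :=
      Finset.insert_subset (hsub M hM hiM) ((Finset.erase_subset _ _).trans (hsub L hL))
    have htD : t ∈ D α (insert i (L.erase j)) := by
      rw [(hα.circuit_spec hcard).2.2]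
      exact hvanish _ (Rel_mono α hL' (hα.circuit_spec hcard).1)
    obtain ⟨x, hx⟩ := mem_D.1 htD
    obtain ⟨y, hy⟩ := mem_D.1 (ht L hL).1
    have hxy : x = y := hα.point_unique hjcard fun p hp => by
      rw [hx p (Finset.mem_insert_of_mem hp), hy p (Finset.mem_of_mem_erase hp)]
    refine inter_eq_empty_iff.1 ((ht L hL).2 i hiL) (mem_D.2 ⟨y, fun p hp => ?_⟩)
    rcases Finset.mem_insert.1 hp with rfl | hp
    · rw [← hxy]; exact hx p (Finset.mem_insert_self _ _)
    · exact hy p hp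
  · obtain ⟨M, hM, hMI⟩ := Finset.not_subset.1 hIJ'
    have hind : LinearIndepOn ℂ (circuit α) (I : Set (Finset (Fin n))) :=
      (hmin M hM).mono (by exact_mod_cast Finset.subset_erase.2 ⟨hIJ, hMI⟩)
    have h1 := Submodule.finrank_mono
      (span_circuit_le_Rel hα (fun M hM => hJ M (hIJ hM)) hsub)
    rw [finrank_span_circuit hind] at h1
    omega

theorem map_update_eq (h : Module.Dual ℂ (Fin n → ℂ)) (t : Fin n → ℂ) (l : Fin n) (c : ℂ) :
    h (Function.update t l c) = h t + (c - t l) * h (Pi.single l 1) := by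
  have : Function.update t l c = t + (c - t l) • Pi.single l 1 := by
    ext i
    by_cases hi : i = l
    · subst hi; simp
    · simp [hi]
  rw [this, map_add, map_smul, smul_eq_mul]

/-- A translate can be moved in a given direction without creating incidences. -/
theorem exists_ne_zero_forall_notMem_D (α : Fin n → Module.Dual ℂ (Fin k → ℂ))
    (t u : Fin n → ℂ) :
    ∃ ε : ℂ, ε ≠ 0 ∧ ∀ A, t ∉ D α A → t + ε • u ∉ D α A := by
  have hfin : ∀ A ∈ {A | t ∉ D α A}, {ε : ℂ | t + ε • u ∈ D α A}.Finite := by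
    intro A hA
    refine Set.Subsingleton.finite fun a ha b hb => ?_
    by_contra hab
    have hab' : b - a ≠ 0 := sub_ne_zero.2 (Ne.symm hab)
    refine hA ?_
    -- `t` is the affine combination of `t + a • u` and `t + b • u` in which `u` cancels.
    convert D_combo ha hb (b / (b - a)) (-(a / (b - a))) using 1
    ext i
    simp only [Pi.add_apply, Pi.smul_apply, smul_eq_mul]
    field_simp
    ring
  obtain ⟨ε, hε⟩ := (((Set.toFinite _).biUnion hfin).union (Set.finite_singleton 0)).exists_notMem
  simp only [Set.mem_union, Set.mem_iUnion, Set.mem_ofPred_eq, not_or, not_exists,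
    Set.mem_singleton_iff] at hε
  exact ⟨ε, hε.2, hε.1⟩

theorem CentralGeneric.not_linearIndepOn_of_almostKT (hα : CentralGeneric α)
    {T S : Finset (Finset (Fin n))} {l : Fin n} (hT : ∀ L ∈ T, L.card = k + 1)
    (hS : ∀ L ∈ S, L ∈ T ∧ l ∈ L) (hS2 : 1 < S.card) {t : Fin n → ℂ}
    (ht : IsAlmostKT α T l S t)
    (hdep : ∀ t, IsAlmostKT α T l S t → ∃ c, IsKT α T (Function.update t l c)) :
    ¬ LinearIndepOn ℂ (circuit α) (T : Set (Finset (Fin n))) := by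
  intro hind
  obtain ⟨L₁, hL₁, L₂, hL₂, hne⟩ := Finset.one_lt_card.1 hS2
  -- Independence supplies a direction changing the circuit of `L₁` and no other one of `T`.
  obtain ⟨u, hu, hu₁⟩ : ∃ u, (∀ L ∈ T.erase L₁, circuit α L u = 0) ∧ circuit α L₁ u ≠ 0 := by
    by_contra! hcon
    rw [← Finset.insert_erase (hS L₁ hL₁).1, Finset.coe_insert,
      linearIndepOn_insert (by simp)] at hind
    exact hind.2 (mem_span_of_iInter_subset fun u hu => hcon u (by simpa using hu))
  obtain ⟨ε, hε, hεD⟩ := exists_ne_zero_forall_notMem_D α t u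
  have ht' : IsAlmostKT α T l S (t + ε • u) := by
    refine ⟨fun L hL hLS => ⟨?_, fun i hi => ?_⟩, fun L hL => ⟨?_, fun i hi => ?_⟩⟩
    · change t + ε • u ∈ D α L
      have h1 : t ∈ D α L := (ht.1 L hL hLS).1
      have h2 : circuit α L u = 0 := hu L (Finset.mem_erase.2 ⟨fun h => hLS (h ▸ hL₁), hL⟩)
      rw [(hα.circuit_spec (hT L hL)).2.2, Set.mem_ofPred_eq] at h1 ⊢
      rw [map_add, map_smul, h1, h2, smul_zero, add_zero]
    · exact inter_eq_empty_iff.2 (hεD _ (inter_eq_empty_iff.1 ((ht.1 L hL hLS).2 i hi)))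
    · exact inter_eq_empty_iff.2 (hεD _ (inter_eq_empty_iff.1 (ht.2 L hL).1))
    · exact inter_eq_empty_iff.2 (hεD _ (inter_eq_empty_iff.1 ((ht.2 L hL).2 i hi)))
  obtain ⟨c, hc⟩ := hdep t ht
  obtain ⟨c', hc'⟩ := hdep _ ht'
  have hzero : ∀ L ∈ T, ∀ s, IsKT α T s → circuit α L s = 0 := fun L hL s hs =>
    Rel_apply_eq_zero (hα.circuit_spec (hT L hL)).1 (hs L hL).1
  obtain ⟨hT₁, hl₁⟩ := hS L₁ hL₁
  obtain ⟨hT₂, hl₂⟩ := hS L₂ hL₂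
  have e₁ := hzero L₁ hT₁ _ hc
  have e₂ := hzero L₂ hT₂ _ hc
  have e₁' := hzero L₁ hT₁ _ hc'
  have e₂' := hzero L₂ hT₂ _ hc'
  rw [map_update_eq] at e₁ e₂ e₁' e₂'
  rw [map_add, map_smul, smul_eq_mul] at e₁' e₂'
  rw [hu L₂ (Finset.mem_erase.2 ⟨hne.symm, hT₂⟩), mul_zero, add_zero] at e₂'
  -- The equation of `L₂` forces the same shift of `H_l` for both translates; the equations of `L₁`
  -- then differ by `ε` times its circuit at `u`, which is nonzero.
  have hd : (c' - (t + ε • u) l) - (c - t l) = 0 :=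
    (mul_eq_zero.1 (by linear_combination e₂' - e₂ :
      ((c' - (t + ε • u) l) - (c - t l)) * circuit α L₂ (Pi.single l 1) = 0)).resolve_right
      ((hα.circuit_spec (hT L₂ hT₂)).2.1 l hl₂)
  exact mul_ne_zero hε hu₁
    (by linear_combination e₁' - e₁ - circuit α L₁ (Pi.single l 1) * hd)

end Translates

end DiscArr

/-! ### The main theorem -/

theorem mainTheorem1 (n k : ℕ) (hkn : k < n) (α : Fin n → Module.Dual ℂ (Fin k → ℂ))
    (hα : DiscArr.CentralGeneric α) (r s : ℕ) (hs : 1 < s)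
    (hdep : DiscArr.IsDependent α r s) : ¬ DiscArr.VeryGeneric α := by
  obtain ⟨T, l, S, ⟨-, hT, -, -⟩, -, -, hS, rfl, ⟨t, ht⟩, hKT⟩ := hdep
  have hTdep := hα.not_linearIndepOn_of_almostKT hT hS hs ht hKT
  obtain ⟨c, hc⟩ := hKT t ht
  -- Passing to a matroid circuit `J ⊆ T` is harmless: a `K_T`-translate is also `K_J`.
  obtain ⟨J, hJT, hJ⟩ := exists_minimal_le_of_wellFoundedLT
    (fun J : Finset (Finset (Fin n)) =>
      ¬ LinearIndepOn ℂ (DiscArr.circuit α) (J : Set (Finset (Fin n)))) T hTdep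
  have hJcard : ∀ L ∈ J, L.card = k + 1 := fun L hL => hT L (hJT hL)
  have hmin : ∀ L ∈ J, LinearIndepOn ℂ (DiscArr.circuit α)
      ((J.erase L : Finset _) : Set (Finset (Fin n))) := fun L hL => by
    by_contra hcon
    exact hJ.not_prop_of_lt (Finset.erase_ssubset hL) hcon
  have hJ2 := hα.one_lt_card_of_dependent hJcard hJ.prop
  obtain ⟨γ, hγ⟩ := DiscArr.exists_relationMap_injective hJcard
    (fun I hIJ hI => hα.hall_of_isKT hJcard hJ2 hmin (fun L hL => hc L (hJT hL)) hIJ hI) hJ2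
  obtain ⟨β, hβ, hβα, hβJ⟩ := hα.exists_perturbation (hα.one_le hkn) hJcard hγ
  rintro ⟨-, hmax⟩
  refine (hmax β hβ).not_gt ?_
  rw [hα.intersectionLattice_eq, hβ.intersectionLattice_eq]
  exact DiscArr.ncard_flatLattice_lt
    (fun B hB => hβα B fun L hL => (Finset.mem_filter.1 (hB hL)).2)
    (fun L hL => Finset.mem_filter.2 ⟨Finset.mem_univ _, hJcard L hL⟩) hJ.prop hβJ hmin hJ2
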